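/- Let $N\ge 2$, let $p,q$ be co-prime positive integers, and let $x_0,y_0,\varphi_x,\varphi_y\in\mathbb R$. A motion is a map $\mathcal M(\tau)=(r_1(\tau),\dots,r_N(\tau))$ with $r_i(\tau)\in\mathbb R^2$. The Type I formation is the motion $$r_i(\tau)=\Big(x_0\sin\big[2\pi p\big(\tau+\tfrac iN\big)+\varphi_x\big],\ y_0\sin\big[2\pi q\big(\tau+\tfrac iN\big)+\varphi_y\big]\Big),\qquad i=1,\dots,N,$$ and the Type II formation is the motion $$r_i(\tau)=\Big(x_0\sin\big[2\pi\big(p\tau+\tfrac iN\big)+\varphi_x\big],\ y_0\sin\big[2\pi\big(q\tau+\tfrac iN\big)+\varphi_y\big]\Big),\qquad i=1,\dots,N;$$ both have period $1$ in $\tau$. A formation is collision-free if $r_i(\tau)\ne r_j(\tau)$ for all $\tau$ and all $i\neq j$. In that case, for $i\ne j$, let $w_{i,j}=\frac1{2\pi}\arg\big(r_j(\tau)-r_i(\tau)\big)\big|_{\tau=0}^{1}$, for a continuous branch of the argument, be the number of turns that the $j$-th satellite makes about the $i$-th one over the period. Let $\mathcal M_0$ be a collision-free motion of period $1$ and let $\mathcal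 M_1(\tau)\equiv\mathcal M_0(0)$ be the constant motion. $\mathcal M_0$ is weakly entangled if there is no family of motions $\mathcal M_\alpha(\tau)$, continuous in $(\alpha,\tau)\in[0,1]^2$, without collisions, that joins $\mathcal M_0$ to $\mathcal M_1$ and satisfies $\mathcal M_\alpha(0)=\mathcal M_\alpha(1)$ for all $\alpha\in[0,1]$. $\mathcal M_0$ is strongly entangled if there is no such family even when the last condition is relaxed to $\mathcal M_\alpha(0)=R_{\varphi(\alpha)}\mathcal M_\alpha(1)$ for all $\alpha\in[0,1]$, for some continuous function $\varphi:[0,1]\to\mathbb R$, where $R_\varphi$ rotates all the positions about the origin by the angle $\varphi$. (a) Consider a collision-free formation of Type I or Type II. If at least one of $p,q$ is even, then $w_{i,j}=0$ for all $i\ne j$. If both $p,q$ are odd, then $w_{i,j}=\pm1$ for all $i\neq j$, and consequently the motion is weakly entangled. (b) Consider a collision-free formation of Type I and suppose that $p,q$ are both odd, so that $w_{i,j}=\pm 1$ for all $i\neq j$ by (a). Then both values $+1$ and $-1$ occur among the winding numbers $w_{i,j}$, $i\ne j$, if and only if neither $q-p$ nor $q+p$ is divisible by $2N$. Consequently, if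 neither $q-p$ nor $q+p$ is divisible by $2N$, then the motion is not only weakly but also strongly entangled. -/

import Mathlib

open Set

noncomputable section

/-- The position of the `i`-th deputy satellite (`i = 1, …, N`, here `i.val + 1` for `i : Fin N`) at
the non-dimensional time `τ` in a formation of Type I. The `xy`-plane is identified with `ℂ`: the
position `(x, y)` is the complex number `x + i y`. -/
def typeI (N p q : ℕ) (x₀ y₀ φx φy : ℝ) (τ : ℝ) (i : Fin N) : ℂ :=
  ⟨x₀ * Real.sin (2 * Real.pi * p * (τ + ((i : ℕ) + 1 : ℝ) / N) + φx),
    y₀ * Real.sin (2 * Real.pi * q * (τ + ((i : ℕ) + 1 : ℝ) / N) + φy)⟩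

/-- The position of the `i`-th deputy satellite at time `τ` in a formation of Type II. -/
def typeII (N p q : ℕ) (x₀ y₀ φx φy : ℝ) (τ : ℝ) (i : Fin N) : ℂ :=
  ⟨x₀ * Real.sin (2 * Real.pi * (p * τ + ((i : ℕ) + 1 : ℝ) / N) + φx),
    y₀ * Real.sin (2 * Real.pi * (q * τ + ((i : ℕ) + 1 : ℝ) / N) + φy)⟩

/-- The satellites never collide: at each time distinct satellites have distinct positions. -/
def CollisionFree {N : ℕ} (M : ℝ → Fin N → ℂ) : Prop :=
  ∀ τ : ℝ, ∀ i j : Fin N, i ≠ j → M τ i ≠ M τ j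

/-- The planar curve `γ τ`, `τ ∈ [0, 1]`, avoids the origin and `w` is the number of turns that it
makes about the origin: `w = (θ 1 - θ 0) / (2 π)` for a continuous determination `θ` of the argument
along the curve. -/
def HasWindingNumber (γ : ℝ → ℂ) (w : ℝ) : Prop :=
  (∀ τ ∈ Icc (0 : ℝ) 1, γ τ ≠ 0) ∧
    ∃ θ : ℝ → ℝ, ContinuousOn θ (Icc 0 1) ∧
      (∀ τ ∈ Icc (0 : ℝ) 1, γ τ = (‖γ τ‖ : ℂ) * Complex.exp ((θ τ : ℂ) * Complex.I)) ∧
      w = (θ 1 - θ 0) / (2 * Real.pi)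

/-- The winding number does not depend on the determination of the argument. -/
theorem HasWindingNumber.unique {γ : ℝ → ℂ} {w w' : ℝ} (h : HasWindingNumber γ w)
    (h' : HasWindingNumber γ w') : w = w' := by
  obtain ⟨h0, θ, hθ, hγ, rfl⟩ := h
  obtain ⟨-, η, hη, hγ', rfl⟩ := h'
  have key : ∀ τ ∈ Icc (0 : ℝ) 1, ∃ n : ℤ, θ τ - η τ = n * (2 * Real.pi) := by
    intro τ hτ
    have hn : (‖γ τ‖ : ℂ) ≠ 0 := by
      simpa using h0 τ hτ
    have e2 : Complex.exp ((θ τ : ℂ) * Complex.I) = Complex.exp ((η τ : ℂ) * Complex.I) :=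
      mul_left_cancel₀ hn ((hγ τ hτ).symm.trans (hγ' τ hτ))
    obtain ⟨n, hn⟩ := Complex.exp_eq_exp_iff_exists_int.1 e2
    refine ⟨n, ?_⟩
    have h3 := congrArg Complex.im hn
    simp at h3
    linarith
  have hc : ContinuousOn (fun τ => (θ τ - η τ) / (2 * Real.pi)) (Icc 0 1) :=
    (hθ.sub hη).div_const _
  have hm : MapsTo (fun τ => (θ τ - η τ) / (2 * Real.pi)) (Icc 0 1)
      (range ((↑) : ℤ → ℝ)) := by
    intro τ hτ
    obtain ⟨n, hn⟩ := key τ hτ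
    refine ⟨n, ?_⟩
    have := Real.pi_pos
    simp only [hn]
    field_simp
  have hd : IsDiscrete (range ((↑) : ℤ → ℝ)) :=
    ⟨(Int.isClosedEmbedding_coe_real.isEmbedding.toHomeomorph).symm.isEmbedding.discreteTopology⟩
  have h01 := isPreconnected_Icc.constant_of_mapsTo hd hc hm
    (right_mem_Icc.2 zero_le_one) (left_mem_Icc.2 zero_le_one)
  simp only [sub_div] at h01 ⊢
  linarith

/-- `w_{i,j} = w`: the number of turns that the `j`-th satellite makes about the `i`-th satellite
over the period `τ ∈ [0, 1]` is `w`. -/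
def PairWinding {N : ℕ} (M : ℝ → Fin N → ℂ) (i j : Fin N) (w : ℝ) : Prop :=
  HasWindingNumber (fun τ => M τ j - M τ i) w

/-- `H α τ`, `α, τ ∈ [0, 1]`, is a continuous family of collision-free motions that deforms the
motion `M` into the constant motion at the initial position of `M`. -/
def StraightensWithoutCollisions {N : ℕ} (M : ℝ → Fin N → ℂ) (H : ℝ → ℝ → Fin N → ℂ) : Prop :=
  ContinuousOn (fun a : ℝ × ℝ => H a.1 a.2) (Icc 0 1 ×ˢ Icc 0 1) ∧
    (∀ τ ∈ Icc (0 : ℝ) 1, H 0 τ = M τ) ∧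
    (∀ τ ∈ Icc (0 : ℝ) 1, H 1 τ = M 0) ∧
    ∀ α ∈ Icc (0 : ℝ) 1, ∀ τ ∈ Icc (0 : ℝ) 1, ∀ i j : Fin N, i ≠ j → H α τ i ≠ H α τ j

/-- The motion `M` is strongly homotopic to the constant map: it can be straightened without
collisions through periodic motions. -/
def StronglyHomotopicToConst {N : ℕ} (M : ℝ → Fin N → ℂ) : Prop :=
  ∃ H : ℝ → ℝ → Fin N → ℂ, StraightensWithoutCollisions M H ∧
    ∀ α ∈ Icc (0 : ℝ) 1, H α 0 = H α 1

/-- The motion `M` is weakly homotopic to the constant map: it can be straightened without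
collisions through motions that are periodic up to a rotation by an angle `φ α`, common to all
satellites and varying continuously with `α`. -/
def WeaklyHomotopicToConst {N : ℕ} (M : ℝ → Fin N → ℂ) : Prop :=
  ∃ (H : ℝ → ℝ → Fin N → ℂ) (φ : ℝ → ℝ), StraightensWithoutCollisions M H ∧
    ContinuousOn φ (Icc 0 1) ∧
    ∀ α ∈ Icc (0 : ℝ) 1, ∀ i : Fin N,
      H α 0 i = Complex.exp ((φ α : ℂ) * Complex.I) * H α 1 i

/-- Weak entanglement: not strongly homotopic to the constant map. -/
def WeaklyEntangled {N : ℕ} (M : ℝ → Fin N → ℂ) : Prop := ¬ StronglyHomotopicToConst M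

/-- Strong entanglement: not weakly homotopic to the constant map. -/
def StronglyEntangled {N : ℕ} (M : ℝ → Fin N → ℂ) : Prop := ¬ WeaklyHomotopicToConst M

end

/-! By sum-to-product, the relative position of two satellites is a Lissajous curve `(a cos(2πpτ +
α), b cos(2πqτ + β))`, so everything reduces to how such a curve turns about the origin.

If exactly one frequency is even, half a period acts as a reflection in an axis. Hence `θ (τ + 1/2)
+ θ τ` is constant, and `θ 1 = θ 0`. If both are odd, the turning is read off at the `2p` crossings
of the imaginary axis: between consecutive crossings the curve stays in a half-plane, and the
argument changes by `±π/2` times the jump of the sign of the ordinate. The total is an alternating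
sum of signs of cosines, equal to `±2`. This gives one turn, with sign `(-1)^((p+q)/2) sign(a b
sin(pβ - qα))` (`hasWindingNumber_lissajous_of_odd`).

In Type I, `pβ - qα` is the same for all pairs, so the sign of `w_{i,j}` varies only with
`sin(πpd/N) sin(πqd/N)`, `d = j - i`. If `q ≡ ±p` mod `2N`, this is plus or minus a square;
otherwise its sum over `d` vanishes, so both signs occur.

A straightening through motions closed up to rotation by `φ α` forces every `w_{i,j}` to equal `(φ 1
- φ 0)/(2π)` (`StraightensWithoutCollisions.pairWinding_eq`). Strict periodicity then forces zero,
and a common rotation forces equality; the computed windings contradict these. -/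

/-! ### Continuous arguments and their rigidity -/

/-- A nowhere vanishing continuous function on a simply connected space has a continuous
determination of its argument. -/
theorem exists_continuous_argument {X : Type*} [TopologicalSpace X] [SimplyConnectedSpace X]
    [LocallyPathConnectedSpace X] {f : X → ℂ} (hf : Continuous f) (h0 : ∀ x, f x ≠ 0) :
    ∃ θ : X → ℝ, Continuous θ ∧ ∀ x, f x = (‖f x‖ : ℂ) * Complex.exp ((θ x : ℂ) * Complex.I) := by
  obtain ⟨x₀⟩ : Nonempty X := inferInstance
  obtain ⟨F, ⟨-, hF⟩, -⟩ := Complex.isCoveringMapOn_exp.existsUnique_continuousMap_lifts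
    ⟨f, hf⟩ (a₀ := x₀) (e₀ := Complex.log (f x₀)) (Complex.exp_log (h0 x₀)) h0
  refine ⟨fun x => (F x).im, Complex.continuous_im.comp F.continuous, fun x => ?_⟩
  have hx : Complex.exp (F x) = f x := congrFun hF x
  rw [← hx, Complex.norm_exp, Complex.ofReal_exp, ← Complex.exp_add, Complex.re_add_im]

/-- Two determinations of the argument of the same number differ by a multiple of `2 π`. -/
theorem exists_int_sub_eq_of_exp_eq {x y : ℝ}
    (h : Complex.exp ((x : ℂ) * Complex.I) = Complex.exp ((y : ℂ) * Complex.I)) :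
    ∃ n : ℤ, x - y = n * (2 * Real.pi) := by
  obtain ⟨n, hn⟩ := Complex.exp_eq_exp_iff_exists_int.1 h
  refine ⟨n, ?_⟩
  have h3 := congrArg Complex.im hn
  simp at h3
  linarith

/-- The values of `f` differ by elements of the discrete set `2πℤ`, so connectedness freezes them.
All later constancy statements about arguments rest on this. -/
theorem eq_of_continuousOn_of_exp_eq {X : Type*} [TopologicalSpace X] {s : Set X}
    (hs : IsPreconnected s) {f : X → ℝ} (hf : ContinuousOn f s) {c : ℂ}
    (hc : ∀ x ∈ s, Complex.exp ((f x : ℂ) * Complex.I) = c) {x y : X} (hx : x ∈ s) (hy : y ∈ s) :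
    f x = f y := by
  have hd : IsDiscrete (range ((↑) : ℤ → ℝ)) :=
    ⟨(Int.isClosedEmbedding_coe_real.isEmbedding.toHomeomorph).symm.isEmbedding.discreteTopology⟩
  have hm : MapsTo (fun z => (f z - f y) / (2 * Real.pi)) s (range ((↑) : ℤ → ℝ)) := by
    intro z hz
    obtain ⟨n, hn⟩ := exists_int_sub_eq_of_exp_eq ((hc z hz).trans (hc y hy).symm)
    refine ⟨n, ?_⟩
    have := Real.pi_pos
    simp only [hn]
    field_simp
  have h : (f x - f y) / (2 * Real.pi) = (f y - f y) / (2 * Real.pi) :=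
    hs.constant_of_mapsTo hd ((hf.sub continuousOn_const).div_const _) hm hx hy
  have := Real.pi_pos
  rw [sub_self, zero_div, div_eq_zero_iff] at h
  rcases h with h | h <;> linarith

theorem exp_mul_I_eq_div_norm {z : ℂ} (hz : z ≠ 0) {t : ℝ}
    (h : z = (‖z‖ : ℂ) * Complex.exp ((t : ℂ) * Complex.I)) :
    Complex.exp ((t : ℂ) * Complex.I) = z / ‖z‖ := by
  rw [eq_div_iff (by simpa using hz), mul_comm]
  exact h.symm

/-! ### Winding numbers as obstructions to straightening -/

/-- A closed curve avoiding the origin that is deformed to a constant curve, in the complement of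
the origin and through curves that close up to a rotation by the angle `φ α`. -/
theorem HasWindingNumber.eq_of_homotopy {γ : ℝ → ℂ} {w : ℝ} (hw : HasWindingNumber γ w)
    {G : ℝ → ℝ → ℂ} {φ : ℝ → ℝ} {z : ℂ}
    (hG : ContinuousOn (fun a : ℝ × ℝ => G a.1 a.2) (Icc 0 1 ×ˢ Icc 0 1))
    (hne : ∀ α ∈ Icc (0 : ℝ) 1, ∀ τ ∈ Icc (0 : ℝ) 1, G α τ ≠ 0)
    (h0 : ∀ τ ∈ Icc (0 : ℝ) 1, G 0 τ = γ τ) (h1 : ∀ τ ∈ Icc (0 : ℝ) 1, G 1 τ = z)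
    (hφ : ContinuousOn φ (Icc 0 1))
    (hrot : ∀ α ∈ Icc (0 : ℝ) 1, G α 0 = Complex.exp ((φ α : ℂ) * Complex.I) * G α 1) :
    w = (φ 1 - φ 0) / (2 * Real.pi) := by
  have m0 : (0 : ℝ) ∈ Icc (0 : ℝ) 1 := left_mem_Icc.2 zero_le_one
  have m1 : (1 : ℝ) ∈ Icc (0 : ℝ) 1 := right_mem_Icc.2 zero_le_one
  -- Clamping both variables extends the homotopy to the whole plane, which is simply connected, so
  -- one argument `Θ` serves all the curves.
  let P : ℝ → ℝ := fun t => projIcc (0 : ℝ) 1 zero_le_one t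
  have hP : ∀ t, P t ∈ Icc (0 : ℝ) 1 := fun t => (projIcc (0 : ℝ) 1 zero_le_one t).2
  have hPc : Continuous P := continuous_subtype_val.comp continuous_projIcc
  have hPe : ∀ t ∈ Icc (0 : ℝ) 1, P t = t := fun t ht => by
    simp [P, projIcc_of_mem zero_le_one ht]
  have hc : Continuous fun a : ℝ × ℝ => G (P a.1) (P a.2) :=
    hG.comp_continuous (f := fun a : ℝ × ℝ => (P a.1, P a.2)) (by fun_prop)
      fun a => ⟨hP _, hP _⟩
  obtain ⟨Θ, hΘ, hΘG⟩ := exists_continuous_argument hc fun a => hne _ (hP _) _ (hP _)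
  have key : ∀ α ∈ Icc (0 : ℝ) 1, ∀ τ ∈ Icc (0 : ℝ) 1,
      G α τ = (‖G α τ‖ : ℂ) * Complex.exp ((Θ (α, τ) : ℂ) * Complex.I) := by
    intro α hα τ hτ
    have := hΘG (α, τ)
    simpa only [hPe α hα, hPe τ hτ] using this
  have hw0 : w = (Θ (0, 1) - Θ (0, 0)) / (2 * Real.pi) := by
    refine hw.unique ⟨hw.1, fun τ => Θ (0, τ), by fun_prop, fun τ hτ => ?_, rfl⟩
    rw [← h0 τ hτ]
    exact key 0 m0 τ hτ
  have hw1 : Θ (1, 1) = Θ (1, 0) := by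
    refine eq_of_continuousOn_of_exp_eq (f := fun τ => Θ (1, τ)) (c := z / ‖z‖)
      isPreconnected_Icc (by fun_prop) (fun τ hτ => ?_) m1 m0
    rw [← h1 τ hτ]
    exact exp_mul_I_eq_div_norm (hne 1 m1 τ hτ) (key 1 m1 τ hτ)
  -- The rotation condition says that this combination is a multiple of `2π` for every `α`.
  have hconst : Θ (0, 0) - Θ (0, 1) - φ 0 = Θ (1, 0) - Θ (1, 1) - φ 1 := by
    refine eq_of_continuousOn_of_exp_eq (f := fun α => Θ (α, 0) - Θ (α, 1) - φ α) (c := 1)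
      isPreconnected_Icc (ContinuousOn.sub (by fun_prop) hφ) (fun α hα => ?_) m0 m1
    have e0 := exp_mul_I_eq_div_norm (hne α hα 0 m0) (key α hα 0 m0)
    have e1 := exp_mul_I_eq_div_norm (hne α hα 1 m1) (key α hα 1 m1)
    have hn : ‖G α 0‖ = ‖G α 1‖ := by
      rw [hrot α hα, norm_mul, Complex.norm_exp_ofReal_mul_I, one_mul]
    push_cast
    rw [sub_mul, sub_mul, Complex.exp_sub, Complex.exp_sub, e0, e1, hn, hrot α hα]
    have := hne α hα 1 m1
    have h2 : (‖G α 1‖ : ℂ) ≠ 0 := by simpa using this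
    have h3 := Complex.exp_ne_zero ((φ α : ℂ) * Complex.I)
    field_simp
  rw [hw0]
  congr 1
  linarith

/-- If a motion can be straightened without collisions through motions that close up to the
rotation by `φ α`, then all its pairwise winding numbers are the number of turns made by `φ`. -/
theorem StraightensWithoutCollisions.pairWinding_eq {N : ℕ} {M : ℝ → Fin N → ℂ}
    {H : ℝ → ℝ → Fin N → ℂ} (hH : StraightensWithoutCollisions M H) {φ : ℝ → ℝ}
    (hφ : ContinuousOn φ (Icc 0 1))
    (hrot : ∀ α ∈ Icc (0 : ℝ) 1, ∀ i : Fin N,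
      H α 0 i = Complex.exp ((φ α : ℂ) * Complex.I) * H α 1 i)
    {i j : Fin N} (hij : i ≠ j) {w : ℝ} (hw : PairWinding M i j w) :
    w = (φ 1 - φ 0) / (2 * Real.pi) := by
  obtain ⟨hc, h0, h1, hne⟩ := hH
  rw [continuousOn_pi] at hc
  refine HasWindingNumber.eq_of_homotopy hw (G := fun α τ => H α τ j - H α τ i)
    (z := M 0 j - M 0 i) ((hc j).sub (hc i)) (fun α hα τ hτ => ?_) (fun τ hτ => ?_)
    (fun τ hτ => ?_) hφ fun α hα => ?_
  · exact sub_ne_zero.2 (hne α hα τ hτ j i hij.symm)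
  · simp only [h0 τ hτ]
  · simp only [h1 τ hτ]
  · simp only [hrot α hα, mul_sub]

theorem weaklyEntangled_of_pairWinding {N : ℕ} {M : ℝ → Fin N → ℂ} {i j : Fin N} (hij : i ≠ j)
    {w : ℝ} (hw : PairWinding M i j w) (hw0 : w ≠ 0) : WeaklyEntangled M := by
  rintro ⟨H, hH, hper⟩
  refine hw0 ?_
  have := hH.pairWinding_eq (φ := fun _ => 0) continuousOn_const
    (fun α hα k => by simp [hper α hα]) hij hw
  simpa using this

theorem stronglyEntangled_of_pairWinding_ne {N : ℕ} {M : ℝ → Fin N → ℂ} {i j k l : Fin N}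
    (hij : i ≠ j) (hkl : k ≠ l) {w w' : ℝ} (hw : PairWinding M i j w)
    (hw' : PairWinding M k l w') (hne : w ≠ w') : StronglyEntangled M := by
  rintro ⟨H, φ, hH, hφ, hrot⟩
  exact hne ((hH.pairWinding_eq hφ hrot hij hw).trans (hH.pairWinding_eq hφ hrot hkl hw').symm)

/-! ### Lissajous curves: half-period symmetry and axis crossings -/

/-- The Lissajous curve with amplitudes `a`, `b`, frequencies `p`, `q` and phases `α`, `β`. -/
noncomputable def lissajous (p q : ℕ) (a b α β τ : ℝ) : ℂ :=
  ⟨a * Real.cos (2 * Real.pi * p * τ + α), b * Real.cos (2 * Real.pi * q * τ + β)⟩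

theorem continuous_lissajous (p q : ℕ) (a b α β : ℝ) : Continuous (lissajous p q a b α β) := by
  have : lissajous p q a b α β = fun τ =>
      ((a * Real.cos (2 * Real.pi * p * τ + α) : ℝ) : ℂ) +
        ((b * Real.cos (2 * Real.pi * q * τ + β) : ℝ) : ℂ) * Complex.I := by
    funext τ
    exact Complex.mk_eq_add_mul_I _ _
  rw [this]
  fun_prop

theorem lissajous_add_one (p q : ℕ) (a b α β τ : ℝ) :
    lissajous p q a b α β (τ + 1) = lissajous p q a b α β τ := by
  have h : ∀ (n : ℕ) (c : ℝ), Real.cos (2 * Real.pi * n * (τ + 1) + c) =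
      Real.cos (2 * Real.pi * n * τ + c) := by
    intro n c
    rw [← Real.cos_add_nat_mul_two_pi (2 * Real.pi * n * τ + c) n]
    congr 1
    ring
  simp only [lissajous, h]

theorem lissajous_add_half (p q : ℕ) (a b α β τ : ℝ) :
    lissajous p q a b α β (τ + 1 / 2) =
      ⟨(-1) ^ p * (lissajous p q a b α β τ).re, (-1) ^ q * (lissajous p q a b α β τ).im⟩ := by
  have h : ∀ (n : ℕ) (c : ℝ), Real.cos (2 * Real.pi * n * (τ + 1 / 2) + c) =
      (-1) ^ n * Real.cos (2 * Real.pi * n * τ + c) := by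
    intro n c
    rw [← Real.cos_add_nat_mul_pi _ n]
    congr 1
    ring
  simp only [lissajous, h]
  congr 1 <;> ring

/-- If exactly one of the frequencies is even, a Lissajous curve avoiding the origin does not turn
about it: half a period later it is reflected in an axis. -/
theorem hasWindingNumber_lissajous_of_odd_add {p q : ℕ} (h : Odd (p + q)) {a b α β : ℝ}
    (hne : ∀ τ, lissajous p q a b α β τ ≠ 0) :
    HasWindingNumber (lissajous p q a b α β) 0 := by
  obtain ⟨θ, hθ, hγ⟩ := exists_continuous_argument (continuous_lissajous p q a b α β) hne
  set γ := lissajous p q a b α β with hγdef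
  refine ⟨fun τ _ => hne τ, θ, hθ.continuousOn, fun τ _ => hγ τ, ?_⟩
  have hexp : ∀ τ, Complex.exp ((θ τ : ℂ) * Complex.I) = γ τ / ‖γ τ‖ :=
    fun τ => exp_mul_I_eq_div_norm (hne τ) (hγ τ)
  have hconj : ∀ τ, γ (τ + 1 / 2) = (-1) ^ p * (starRingEnd ℂ) (γ τ) := by
    intro τ
    rw [hγdef, lissajous_add_half]
    have hq : (-1 : ℝ) ^ q = - (-1) ^ p := by
      rcases Nat.even_or_odd p with hp | hp
      · have : Odd q := by
          rcases Nat.even_or_odd q with hq | hq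
          · exact absurd h (by simpa using hp.add hq)
          · exact hq
        simp [hp.neg_one_pow, this.neg_one_pow]
      · have : Even q := by
          rcases Nat.even_or_odd q with hq | hq
          · exact hq
          · exact absurd h (by simpa using hp.add_odd hq)
        simp [hp.neg_one_pow, this.neg_one_pow]
    have hz : ((-1 : ℂ) ^ p) = (((-1 : ℝ) ^ p : ℝ) : ℂ) := by push_cast; rfl
    rw [hz, hq]
    apply Complex.ext
    · rw [Complex.re_ofReal_mul, Complex.conj_re]
    · rw [Complex.im_ofReal_mul, Complex.conj_im]
      ring
  -- Conjugation negates the argument, so the sum of the two arguments is fixed modulo `2π`.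
  have hsum : ∀ τ, θ (τ + 1 / 2) + θ τ = θ (0 + 1 / 2) + θ 0 := by
    intro τ
    refine eq_of_continuousOn_of_exp_eq (f := fun τ => θ (τ + 1 / 2) + θ τ) (c := (-1) ^ p)
      isPreconnected_univ (by fun_prop) (fun τ _ => ?_) (mem_univ τ) (mem_univ 0)
    have hn : (‖γ τ‖ : ℂ) ≠ 0 := by simpa using hne τ
    have hn2 : ‖γ (τ + 1 / 2)‖ = ‖γ τ‖ := by
      rw [hconj τ]
      simp
    push_cast
    rw [add_mul, Complex.exp_add, hexp, hexp, hn2, hconj τ, div_mul_div_comm, mul_assoc,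
      mul_comm ((starRingEnd ℂ) (γ τ)), Complex.mul_conj, Complex.normSq_eq_norm_sq]
    push_cast
    field_simp
  have h1 := hsum (1 / 2)
  norm_num at h1
  rw [show θ 1 = θ 0 by linarith, sub_self, zero_div]

theorem argument_sub_of_re_nonneg {γ : ℝ → ℂ} {θ : ℝ → ℝ} (hγ : Continuous γ) (hθ : Continuous θ)
    (hne : ∀ τ, γ τ ≠ 0)
    (h : ∀ τ, γ τ = (‖γ τ‖ : ℂ) * Complex.exp ((θ τ : ℂ) * Complex.I))
    {s t : ℝ} (hst : s ≤ t) (hre : ∀ τ ∈ Icc s t, 0 ≤ (γ τ).re) (hs : (γ s).re = 0)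
    (ht : (γ t).re = 0) :
    θ t - θ s = Real.pi / 2 *
      ((SignType.sign (γ t).im : ℝ) - (SignType.sign (γ s).im : ℝ)) := by
  -- The closed right half-plane without the origin misses the cut, so the principal argument is
  -- continuous there.
  have hslit : ∀ τ ∈ Icc s t, γ τ ∈ Complex.slitPlane := by
    intro τ hτ
    rw [Complex.mem_slitPlane_iff]
    rcases (hre τ hτ).lt_or_eq with h0 | h0
    · exact Or.inl h0
    · exact Or.inr fun h1 => hne τ (Complex.ext h0.symm h1)
  have hconst : θ t - (γ t).arg = θ s - (γ s).arg := by
    refine eq_of_continuousOn_of_exp_eq (f := fun τ => θ τ - (γ τ).arg) (c := 1)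
      isPreconnected_Icc (hθ.continuousOn.sub fun τ hτ =>
        ((Complex.continuousAt_arg (hslit τ hτ)).comp
          hγ.continuousAt).continuousWithinAt) (fun τ _ => ?_)
      (right_mem_Icc.2 hst) (left_mem_Icc.2 hst)
    have h1 := exp_mul_I_eq_div_norm (hne τ) (h τ)
    have h2 := exp_mul_I_eq_div_norm (hne τ) (Complex.norm_mul_exp_arg_mul_I (γ τ)).symm
    push_cast
    rw [sub_mul, Complex.exp_sub, h1, h2, div_self]
    exact div_ne_zero (hne τ) (by simpa using hne τ)
  have harg : ∀ τ, (γ τ).re = 0 → (γ τ).arg = Real.pi / 2 * (SignType.sign (γ τ).im : ℝ) := by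
    intro τ h0
    rcases lt_trichotomy (γ τ).im 0 with h1 | h1 | h1
    · rw [Complex.arg_eq_neg_pi_div_two_iff.2 ⟨h0, h1⟩, sign_neg h1]
      simp
    · exact absurd (Complex.ext h0 h1) (hne τ)
    · rw [Complex.arg_eq_pi_div_two_iff.2 ⟨h0, h1⟩, sign_pos h1]
      simp
  rw [harg t ht, harg s hs] at hconst
  linarith

/-- The increment of the argument between two crossings of the imaginary axis. -/
theorem argument_sub_of_mul_re_nonneg {γ : ℝ → ℂ} {θ : ℝ → ℝ} (hγ : Continuous γ)
    (hθ : Continuous θ) (hne : ∀ τ, γ τ ≠ 0)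
    (h : ∀ τ, γ τ = (‖γ τ‖ : ℂ) * Complex.exp ((θ τ : ℂ) * Complex.I))
    {s t : ℝ} (hst : s ≤ t) {e : ℝ} (he : e = 1 ∨ e = -1)
    (hre : ∀ τ ∈ Icc s t, 0 ≤ e * (γ τ).re) (hs : (γ s).re = 0) (ht : (γ t).re = 0) :
    θ t - θ s = e * (Real.pi / 2 *
      ((SignType.sign (γ t).im : ℝ) - (SignType.sign (γ s).im : ℝ))) := by
  rcases he with rfl | rfl
  · rw [one_mul]
    exact argument_sub_of_re_nonneg hγ hθ hne h hst (by simpa using hre) hs ht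
  -- The left half-plane is reduced to the right one by negating the curve and adding `π` to its
  -- argument.
  · have := argument_sub_of_re_nonneg (γ := fun τ => -γ τ) (θ := fun τ => θ τ + Real.pi)
      hγ.neg (by fun_prop) (fun τ => neg_ne_zero.2 (hne τ)) (fun τ => ?_) hst
      (by simpa using hre) (by simpa using hs) (by simpa using ht)
    · simp only [Complex.neg_im, Left.sign_neg, SignType.coe_neg] at this
      linarith
    · rw [norm_neg]
      push_cast
      rw [add_mul, Complex.exp_add, Complex.exp_pi_mul_I, mul_neg_one, mul_neg, ← h τ]

/-! ### Alternating sums of signs of cosines -/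

/-- Summation of a periodic function over a period is invariant under multiplication of the
argument by a number prime to the period. -/
theorem sum_range_mul_of_coprime {n q : ℕ} (hn : 0 < n) (hq : Nat.Coprime q n) {f : ℕ → ℝ}
    (hf : ∀ k, f (k % n) = f k) :
    ∑ k ∈ Finset.range n, f (q * k) = ∑ k ∈ Finset.range n, f k := by
  have hmaps : ∀ k ∈ Finset.range n, q * k % n ∈ Finset.range n :=
    fun k _ => Finset.mem_range.2 (Nat.mod_lt _ hn)
  have hinj : Set.InjOn (fun k => q * k % n) (Finset.range n : Set ℕ) := by
    intro k hk l hl hkl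
    have : k ≡ l [MOD n] := Nat.ModEq.cancel_left_of_coprime
      (by simpa [Nat.coprime_comm] using hq) hkl
    exact Nat.ModEq.eq_of_lt_of_lt this (by simpa using hk) (by simpa using hl)
  refine Finset.sum_nbij (fun k => q * k % n) hmaps hinj ?_ fun k _ => (hf _).symm
  exact Finset.surjOn_of_injOn_of_card_le _ hmaps hinj le_rfl

/-- The shift moves each sample point to the next, which flips the alternation; the end terms match
because they differ by a full turn. -/
theorem antiperiodic_sum_neg_one_pow_mul_sign_cos {p : ℕ} (hp : 0 < p) :
    Function.Antiperiodic (fun x : ℝ => ∑ m ∈ Finset.range (2 * p),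
      (-1 : ℝ) ^ m * (SignType.sign (Real.cos (x + m * Real.pi / p)) : ℝ)) (Real.pi / p) := by
  intro x
  have hp' : (p : ℝ) ≠ 0 := by positivity
  set f : ℕ → ℝ := fun m =>
    (-1 : ℝ) ^ m * (SignType.sign (Real.cos (x + m * Real.pi / p)) : ℝ) with hf
  have h1 : ∀ m : ℕ, (-1 : ℝ) ^ m *
      (SignType.sign (Real.cos (x + Real.pi / p + m * Real.pi / p)) : ℝ) = - f (m + 1) := by
    intro m
    simp only [hf]
    rw [show x + Real.pi / p + m * Real.pi / p = x + ((m + 1 : ℕ) : ℝ) * Real.pi / p by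
      push_cast; ring]
    ring
  have h2 : f (2 * p) = f 0 := by
    simp only [hf]
    rw [show x + ((2 * p : ℕ) : ℝ) * Real.pi / p = x + 2 * Real.pi by push_cast; field_simp]
    simp [Real.cos_add_two_pi]
  simp only [h1, Finset.sum_neg_distrib, neg_inj]
  have h3 := Finset.sum_range_succ f (2 * p)
  rw [Finset.sum_range_succ', h2] at h3
  linarith

theorem antiperiodic_sin_mul {p : ℕ} (hp : 0 < p) :
    Function.Antiperiodic (fun x : ℝ => Real.sin (p * (x + Real.pi / 2))) (Real.pi / p) := by
  intro x
  have hp' : (p : ℝ) ≠ 0 := by positivity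
  simp only
  rw [← Real.sin_add_pi]
  congr 1
  field_simp
  ring

theorem sum_range_neg_one_pow_of_odd {p : ℕ} (hp : Odd p) :
    ∑ m ∈ Finset.range p, (-1 : ℝ) ^ m = 1 := by
  rw [neg_one_geom_sum, if_neg (Nat.not_even_iff_odd.2 hp)]

/-- The alternating sum of the signs of `cos` at `2 p` equally spaced points. -/
theorem sum_neg_one_pow_mul_sign_cos {p : ℕ} (hp : Odd p) {c : ℝ}
    (hc : ∀ m : ℤ, Real.cos (c + m * Real.pi / p) ≠ 0) :
    Real.sin (p * (c + Real.pi / 2)) ≠ 0 ∧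
    ∑ m ∈ Finset.range (2 * p),
        (-1 : ℝ) ^ m * (SignType.sign (Real.cos (c + m * Real.pi / p)) : ℝ) =
      2 * (SignType.sign (Real.sin (p * (c + Real.pi / 2))) : ℝ) := by
  have hp0 : 0 < p := hp.pos
  have hpr : (0 : ℝ) < p := by positivity
  have hpi := Real.pi_pos
  -- Both sides are antiperiodic under `π/p`, so `c` may be moved to `x` with `-π/2 ≤ x < -π/2 +
  -- π/p`. There the first `p` cosines are positive and the last `p` negative.
  set j : ℤ := ⌊(c + Real.pi / 2) * p / Real.pi⌋ with hj
  obtain ⟨x, hx⟩ : ∃ x, c = x + j • (Real.pi / p) := ⟨c - j • (Real.pi / p), by ring⟩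
  have hxc : x = c - j * Real.pi / p := by
    rw [hx, zsmul_eq_mul]
    ring
  have hx0 : 0 < p * (x + Real.pi / 2) := by
    have h1 : 0 ≤ p * (x + Real.pi / 2) := by
      have := Int.floor_le ((c + Real.pi / 2) * p / Real.pi)
      rw [← hj, le_div_iff₀ hpi] at this
      rw [hxc]
      field_simp
      linarith
    -- Equality would mean `x = -π/2`, a zero of the cosine excluded by `hc`.
    refine lt_of_le_of_ne h1 fun h2 => hc (-j) ?_
    rw [show c + ((-j : ℤ) : ℝ) * Real.pi / p = -(Real.pi / 2) by
      rcases mul_eq_zero.1 h2.symm with h3 | h3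
      · exact absurd h3 hpr.ne'
      · rw [hxc] at h3
        push_cast
        linear_combination h3]
    simp
  have hx1 : p * (x + Real.pi / 2) < Real.pi := by
    have := Int.lt_floor_add_one ((c + Real.pi / 2) * p / Real.pi)
    rw [← hj, div_lt_iff₀ hpi] at this
    rw [hxc]
    field_simp
    linarith
  have hsin : 0 < Real.sin (p * (x + Real.pi / 2)) := Real.sin_pos_of_pos_of_lt_pi hx0 hx1
  have hsum : ∑ m ∈ Finset.range (2 * p),
      (-1 : ℝ) ^ m * (SignType.sign (Real.cos (x + m * Real.pi / p)) : ℝ) = 2 := by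
    have hpos : ∀ m ∈ Finset.range p, 0 < Real.cos (x + m * Real.pi / p) := by
      intro m hm
      have hm1 : (m : ℝ) + 1 ≤ p := by exact_mod_cast Finset.mem_range.1 hm
      have hmp : 0 ≤ m * Real.pi / p := by positivity
      have hx0' : 0 < x + Real.pi / 2 := pos_of_mul_pos_right hx0 hpr.le
      have hx1' : x + Real.pi / 2 < Real.pi / p := by
        rw [lt_div_iff₀ hpr]
        linarith
      have h2 : (m + 1) * Real.pi / p ≤ Real.pi := by
        rw [div_le_iff₀ hpr]
        nlinarith
      refine Real.cos_pos_of_mem_Ioo ⟨by linarith, ?_⟩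
      rw [add_mul, add_div, one_mul] at h2
      linarith
    rw [two_mul, Finset.sum_range_add]
    have e1 : ∀ m ∈ Finset.range p,
        (-1 : ℝ) ^ m * (SignType.sign (Real.cos (x + m * Real.pi / p)) : ℝ) = (-1) ^ m := by
      intro m hm
      rw [sign_pos (hpos m hm)]
      simp
    -- As `p` is odd, the factor `(-1)^p` cancels the sign change of the cosine.
    have e2 : ∀ m ∈ Finset.range p, (-1 : ℝ) ^ (p + m) *
        (SignType.sign (Real.cos (x + (p + m : ℕ) * Real.pi / p)) : ℝ) = (-1) ^ m := by
      intro m hm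
      rw [show x + ((p + m : ℕ) : ℝ) * Real.pi / p = x + m * Real.pi / p + Real.pi by
        push_cast
        field_simp
        ring, Real.cos_add_pi, sign_neg (neg_lt_zero.2 (hpos m hm)), pow_add, hp.neg_one_pow]
      simp
    rw [Finset.sum_congr rfl e1, Finset.sum_congr rfl e2, sum_range_neg_one_pow_of_odd hp]
    norm_num
  have hsj := (antiperiodic_sin_mul hp0).add_zsmul_eq (x := x) j
  have hTj := (antiperiodic_sum_neg_one_pow_mul_sign_cos hp0).add_zsmul_eq (x := x) j
  simp only [← hx] at hsj hTj
  rw [hsj, hTj, hsum]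
  rcases Int.even_or_odd j with hj | hj
  · rw [Int.negOnePow_even j hj]
    simp [sign_pos hsin, hsin.ne']
  · rw [Int.negOnePow_odd j hj]
    simp [sign_pos hsin, hsin.ne', Left.sign_neg]

/-! ### Winding number of a Lissajous curve with odd frequencies -/

theorem lissajous_re_eq {p : ℕ} (hp : 0 < p) (q : ℕ) (a b α β x : ℝ) :
    (lissajous p q a b α β ((x - α) / (2 * Real.pi * p))).re = a * Real.cos x := by
  have hpi := Real.pi_pos
  have hp' : (p : ℝ) ≠ 0 := by positivity
  simp only [lissajous]
  congr 2
  field_simp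
  ring

/-- For natural `k` these are the crossing times of the imaginary axis; from one to the next the
phase of the ordinate advances by `qπ/p`. -/
theorem lissajous_im_eq {p : ℕ} (hp : 0 < p) (q : ℕ) (a b α β : ℝ) (k : ℝ) :
    (lissajous p q a b α β ((Real.pi / 2 + k * Real.pi - α) / (2 * Real.pi * p))).im =
      b * Real.cos (q / p * (Real.pi / 2 - α) + β + q * k * Real.pi / p) := by
  have hpi := Real.pi_pos
  have hp' : (p : ℝ) ≠ 0 := by positivity
  simp only [lissajous]
  congr 2
  field_simp
  ring

/-- Since `q` is invertible modulo `2p`, every `m` is congruent to some `qk`; a zero of this cosine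
would put the curve at the origin at the `k`-th crossing. -/
theorem cos_add_int_mul_pi_div_ne_zero_of_lissajous_ne_zero {p q : ℕ} (hp : 0 < p)
    (hq : Odd q) (hpq : Nat.Coprime p q) {a b α β : ℝ}
    (hne : ∀ τ, lissajous p q a b α β τ ≠ 0) (m : ℤ) :
    Real.cos (q / p * (Real.pi / 2 - α) + β + m * Real.pi / p) ≠ 0 := by
  intro h0
  have hpr : (p : ℝ) ≠ 0 := by positivity
  have hcop : IsCoprime (q : ℤ) ((2 * p : ℕ) : ℤ) :=
    Nat.isCoprime_iff_coprime.2 (Nat.Coprime.mul_right hq.coprime_two_right hpq.symm)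
  obtain ⟨u, v, huv⟩ := hcop
  have huv' : (u : ℝ) * q + v * (2 * p) = 1 := by exact_mod_cast huv
  refine hne ((Real.pi / 2 + ((m * u : ℤ) : ℝ) * Real.pi - α) / (2 * Real.pi * p))
    (Complex.ext ?_ ?_)
  · rw [lissajous_re_eq hp, Real.cos_add_int_mul_pi]
    simp
  · rw [lissajous_im_eq hp]
    have : (q : ℝ) / p * (Real.pi / 2 - α) + β + q * ((m * u : ℤ) : ℝ) * Real.pi / p =
        q / p * (Real.pi / 2 - α) + β + m * Real.pi / p - ((m * v : ℤ) : ℝ) * (2 * Real.pi) := by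
      push_cast
      field_simp
      linear_combination (2 * m * Real.pi) * huv'
    rw [this, Real.cos_sub_int_mul_two_pi, h0]
    simp

theorem lissajous_amplitude_ne_zero {p q : ℕ} (hp : 0 < p) (hq : 0 < q) {a b α β : ℝ}
    (hne : ∀ τ, lissajous p q a b α β τ ≠ 0) : a ≠ 0 ∧ b ≠ 0 := by
  have hpi := Real.pi_pos
  have hp' : (p : ℝ) ≠ 0 := by positivity
  have hq' : (q : ℝ) ≠ 0 := by positivity
  constructor
  · rintro rfl
    refine hne ((Real.pi / 2 - β) / (2 * Real.pi * q)) (Complex.ext ?_ ?_)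
    · simp [lissajous]
    · simp only [lissajous]
      rw [show 2 * Real.pi * q * ((Real.pi / 2 - β) / (2 * Real.pi * q)) + β = Real.pi / 2 by
        field_simp
        ring]
      simp
  · rintro rfl
    refine hne ((Real.pi / 2 - α) / (2 * Real.pi * p)) (Complex.ext ?_ ?_)
    · rw [lissajous_re_eq hp]
      simp
    · simp [lissajous]

theorem sign_cast_eq_or {x : ℝ} (hx : x ≠ 0) :
    (SignType.sign x : ℝ) = 1 ∨ (SignType.sign x : ℝ) = -1 := by
  rcases hx.lt_or_gt with h | h
  · right
    simp [sign_neg h]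
  · left
    simp [sign_pos h]

/-- The winding number about the origin of a Lissajous curve with odd frequencies. -/
theorem hasWindingNumber_lissajous_of_odd {p q : ℕ} (hp : Odd p) (hq : Odd q)
    (hpq : Nat.Coprime p q) {a b α β : ℝ} (hne : ∀ τ, lissajous p q a b α β τ ≠ 0) :
    Real.sin (p * β - q * α) ≠ 0 ∧
      HasWindingNumber (lissajous p q a b α β)
        ((-1) ^ ((p + q) / 2) * (SignType.sign a : ℝ) * (SignType.sign b : ℝ) *
          (SignType.sign (Real.sin (p * β - q * α)) : ℝ)) := by
  have hpi := Real.pi_pos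
  have hp0 : 0 < p := hp.pos
  have hpr : (0 : ℝ) < p := by positivity
  obtain ⟨ha, hb⟩ := lissajous_amplitude_ne_zero hp0 hq.pos hne
  set c : ℝ := q / p * (Real.pi / 2 - α) + β with hcdef
  have hcos := cos_add_int_mul_pi_div_ne_zero_of_lissajous_ne_zero hp0 hq hpq hne
  obtain ⟨hsin, hsum⟩ := sum_neg_one_pow_mul_sign_cos hp hcos
  -- The two angles differ by `(p + q)π/2`, a multiple of `π` because `p + q` is even.
  have hsineq : Real.sin (p * (c + Real.pi / 2)) =
      (-1) ^ ((p + q) / 2) * Real.sin (p * β - q * α) := by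
    obtain ⟨r, hr⟩ := hp.add_odd hq
    rw [show (p + q) / 2 = r by omega, ← Real.sin_add_nat_mul_pi]
    have hr' : (p : ℝ) + q = r + r := by exact_mod_cast hr
    congr 1
    rw [hcdef]
    field_simp
    linear_combination Real.pi * hr'
  rw [hsineq] at hsin hsum
  refine ⟨right_ne_zero_of_mul hsin, ?_⟩
  obtain ⟨θ, hθ, hγ⟩ := exists_continuous_argument (continuous_lissajous p q a b α β) hne
  refine ⟨fun τ _ => hne τ, θ, hθ.continuousOn, fun τ _ => hγ τ, ?_⟩
  let t : ℕ → ℝ := fun k => (Real.pi / 2 + k * Real.pi - α) / (2 * Real.pi * p)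
  let s : ℕ → ℝ := fun k => (SignType.sign (Real.cos (c + k * Real.pi / p)) : ℝ)
  have hre : ∀ k, (lissajous p q a b α β (t k)).re = 0 := fun k => by
    simp only [t]
    rw [lissajous_re_eq hp0, Real.cos_add_nat_mul_pi]
    simp
  have him : ∀ k, (SignType.sign (lissajous p q a b α β (t k)).im : ℝ) =
      (SignType.sign b : ℝ) * s (q * k) := fun k => by
    simp only [t, s]
    rw [lissajous_im_eq hp0, sign_mul, SignType.coe_mul]
    push_cast
    rfl
  -- Between these times `cos` has sign `-(-1)^k`, so `-(-1)^k sign a` selects the half-plane.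
  have hstep : ∀ k, θ (t (k + 1)) - θ (t k) = -(-1) ^ k * (SignType.sign a : ℝ) *
      (Real.pi / 2 *
        ((SignType.sign b : ℝ) * s (q * (k + 1)) - (SignType.sign b : ℝ) * s (q * k))) := by
    intro k
    rw [← him, ← him]
    have hle : t k ≤ t (k + 1) := by
      simp only [t]
      gcongr
      exact Nat.le_succ k
    refine argument_sub_of_mul_re_nonneg (continuous_lissajous p q a b α β) hθ hne hγ hle ?_
      (fun τ hτ => ?_) (hre _) (hre _)
    · rcases neg_one_pow_eq_or ℝ k with h | h <;> rcases sign_cast_eq_or ha with h' | h' <;>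
        simp [h, h']
    · have hx : τ = ((2 * Real.pi * p * τ + α) - α) / (2 * Real.pi * p) := by
        field_simp
        ring
      rw [hx, lissajous_re_eq hp0]
      have hτ1 := hτ.1
      have hτ2 := hτ.2
      simp only [t] at hτ1 hτ2
      rw [div_le_iff₀ (by positivity)] at hτ1
      rw [le_div_iff₀ (by positivity)] at hτ2
      push_cast at hτ2
      have h1 : Real.cos (2 * Real.pi * p * τ + α - k * Real.pi) ≤ 0 :=
        Real.cos_nonpos_of_pi_div_two_le_of_le (by linarith) (by linarith)
      rw [Real.cos_sub_nat_mul_pi] at h1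
      have h2 : 0 ≤ (SignType.sign a : ℝ) * a := by
        rw [sign_mul_self]
        exact abs_nonneg a
      nlinarith
  -- The turning over a period does not depend on its start, so it can be measured from `t 0` to `t
  -- (2 * p) = t 0 + 1`.
  have hper : ∀ τ, θ (τ + 1) - θ τ = θ (0 + 1) - θ 0 := by
    intro τ
    refine eq_of_continuousOn_of_exp_eq (f := fun τ => θ (τ + 1) - θ τ) (c := 1)
      isPreconnected_univ (by fun_prop) (fun τ _ => ?_) (mem_univ τ) (mem_univ 0)
    have h1 := exp_mul_I_eq_div_norm (hne τ) (hγ τ)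
    have h2 := exp_mul_I_eq_div_norm (hne _) (hγ (τ + 1))
    rw [lissajous_add_one] at h2
    push_cast
    rw [sub_mul, Complex.exp_sub, h1, h2, div_self]
    exact div_ne_zero (hne τ) (by simpa using hne τ)
  let g : ℕ → ℝ := fun k => (-1) ^ k * s (q * k)
  have hsper : Function.Periodic s (2 * p) := fun k => by
    simp only [s]
    rw [show c + ((k + 2 * p : ℕ) : ℝ) * Real.pi / p = c + k * Real.pi / p + 2 * Real.pi by
      push_cast
      field_simp
      ring, Real.cos_add_two_pi]
  have hfper : Function.Periodic (fun k : ℕ => (-1 : ℝ) ^ k * s k) (2 * p) := fun k => by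
    simp only [hsper k, pow_add, pow_mul]
    simp
  have hgsum : ∑ k ∈ Finset.range (2 * p), g k =
      2 * (SignType.sign ((-1) ^ ((p + q) / 2) * Real.sin (p * β - q * α)) : ℝ) := by
    rw [← hsum]
    -- As `q` is odd, `(-1)^k = (-1)^(qk)`, so the sum over crossings is the alternating sum with
    -- its points permuted by multiplication by `q`.
    have hcop : Nat.Coprime q (2 * p) := Nat.Coprime.mul_right hq.coprime_two_right hpq.symm
    rw [← sum_range_mul_of_coprime (f := fun k => (-1 : ℝ) ^ k * s k) (by positivity) hcop
      fun k => hfper.map_mod_nat k]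
    refine Finset.sum_congr rfl fun k _ => ?_
    rw [pow_mul, hq.neg_one_pow]
  have hgshift : ∑ k ∈ Finset.range (2 * p), g (k + 1) = ∑ k ∈ Finset.range (2 * p), g k := by
    have h1 := Finset.sum_range_succ g (2 * p)
    rw [Finset.sum_range_succ'] at h1
    have h2 : g (2 * p) = g 0 := by
      have := hsper.nat_mul q 0
      simp only [g, mul_zero, pow_zero, one_mul, pow_mul]
      simpa using this
    linarith
  have htot : θ 1 - θ 0 = Real.pi * (SignType.sign a : ℝ) * (SignType.sign b : ℝ) *
      ∑ k ∈ Finset.range (2 * p), g k := by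
    have h1 : θ 1 - θ 0 = θ (t (2 * p)) - θ (t 0) := by
      have h2 := hper (t 0)
      rw [zero_add] at h2
      rw [← h2]
      congr 2
      simp only [t]
      push_cast
      field_simp
      ring
    rw [h1, ← Finset.sum_range_sub (fun k => θ (t k))]
    -- The alternating side turns differences of signs into sums of consecutive values of `g`, so
    -- `g` is counted twice.
    have h3 : ∀ k ∈ Finset.range (2 * p), θ (t (k + 1)) - θ (t k) =
        Real.pi / 2 * (SignType.sign a : ℝ) * (SignType.sign b : ℝ) * (g (k + 1) + g k) := by
      intro k _
      rw [hstep]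
      simp only [g]
      ring
    rw [Finset.sum_congr rfl h3, ← Finset.mul_sum, Finset.sum_add_distrib, hgshift]
    ring
  rw [htot, hgsum, sign_mul, SignType.coe_mul]
  have hs1 : (SignType.sign ((-1 : ℝ) ^ ((p + q) / 2)) : ℝ) = (-1) ^ ((p + q) / 2) := by
    rcases neg_one_pow_eq_or ℝ ((p + q) / 2) with h | h <;> simp [h]
  rw [hs1]
  field_simp

/-! ### Relative motions and winding numbers in the formations -/

theorem typeI_sub (N p q : ℕ) (x₀ y₀ φx φy : ℝ) (i j : Fin N) (τ : ℝ) :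
    typeI N p q x₀ y₀ φx φy τ j - typeI N p q x₀ y₀ φx φy τ i =
      lissajous p q (2 * x₀ * Real.sin (Real.pi * p * (((j : ℕ) : ℝ) - (i : ℕ)) / N))
        (2 * y₀ * Real.sin (Real.pi * q * (((j : ℕ) : ℝ) - (i : ℕ)) / N))
        (Real.pi * p * ((i : ℕ) + (j : ℕ) + 2) / N + φx)
        (Real.pi * q * ((i : ℕ) + (j : ℕ) + 2) / N + φy) τ := by
  have h : ∀ (n : ℕ) (z φ : ℝ),
      z * Real.sin (2 * Real.pi * n * (τ + ((j : ℕ) + 1 : ℝ) / N) + φ) -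
        z * Real.sin (2 * Real.pi * n * (τ + ((i : ℕ) + 1 : ℝ) / N) + φ) =
      2 * z * Real.sin (Real.pi * n * (((j : ℕ) : ℝ) - (i : ℕ)) / N) *
        Real.cos (2 * Real.pi * n * τ + (Real.pi * n * ((i : ℕ) + (j : ℕ) + 2) / N + φ)) := by
    intro n z φ
    rw [← mul_sub, Real.sin_sub_sin, mul_comm 2 z, mul_assoc z, mul_assoc z]
    congr 4 <;> ring
  apply Complex.ext
  · exact h p x₀ φx
  · exact h q y₀ φy

theorem typeII_sub (N p q : ℕ) (x₀ y₀ φx φy : ℝ) (i j : Fin N) (τ : ℝ) :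
    typeII N p q x₀ y₀ φx φy τ j - typeII N p q x₀ y₀ φx φy τ i =
      lissajous p q (2 * x₀ * Real.sin (Real.pi * (((j : ℕ) : ℝ) - (i : ℕ)) / N))
        (2 * y₀ * Real.sin (Real.pi * (((j : ℕ) : ℝ) - (i : ℕ)) / N))
        (Real.pi * ((i : ℕ) + (j : ℕ) + 2) / N + φx)
        (Real.pi * ((i : ℕ) + (j : ℕ) + 2) / N + φy) τ := by
  have h : ∀ (n : ℕ) (z φ : ℝ),
      z * Real.sin (2 * Real.pi * (n * τ + ((j : ℕ) + 1 : ℝ) / N) + φ) -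
        z * Real.sin (2 * Real.pi * (n * τ + ((i : ℕ) + 1 : ℝ) / N) + φ) =
      2 * z * Real.sin (Real.pi * (((j : ℕ) : ℝ) - (i : ℕ)) / N) *
        Real.cos (2 * Real.pi * n * τ + (Real.pi * ((i : ℕ) + (j : ℕ) + 2) / N + φ)) := by
    intro n z φ
    rw [← mul_sub, Real.sin_sub_sin, mul_comm 2 z, mul_assoc z, mul_assoc z]
    congr 4 <;> ring
  apply Complex.ext
  · exact h p x₀ φx
  · exact h q y₀ φy

/-- In both types of formation the relative motion of two satellites is a Lissajous curve. -/
theorem exists_sub_eq_lissajous {N p q : ℕ} {x₀ y₀ φx φy : ℝ} {M : ℝ → Fin N → ℂ}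
    (hM : M = typeI N p q x₀ y₀ φx φy ∨ M = typeII N p q x₀ y₀ φx φy) (i j : Fin N) :
    ∃ a b α β : ℝ, (fun τ => M τ j - M τ i) = lissajous p q a b α β := by
  rcases hM with rfl | rfl
  · exact ⟨_, _, _, _, funext (typeI_sub N p q x₀ y₀ φx φy i j)⟩
  · exact ⟨_, _, _, _, funext (typeII_sub N p q x₀ y₀ φx φy i j)⟩

theorem CollisionFree.lissajous_ne_zero {N : ℕ} {M : ℝ → Fin N → ℂ} (hM : CollisionFree M)
    {i j : Fin N} (hij : i ≠ j) {p q : ℕ} {a b α β : ℝ}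
    (h : (fun τ => M τ j - M τ i) = lissajous p q a b α β) (τ : ℝ) :
    lissajous p q a b α β τ ≠ 0 := by
  rw [← h]
  exact sub_ne_zero.2 (hM τ j i hij.symm)

theorem pairWinding_zero_of_even {N p q : ℕ} {x₀ y₀ φx φy : ℝ} {M : ℝ → Fin N → ℂ}
    (hM : M = typeI N p q x₀ y₀ φx φy ∨ M = typeII N p q x₀ y₀ φx φy) (hcf : CollisionFree M)
    (hpq : Nat.Coprime p q) (he : Even p ∨ Even q) {i j : Fin N} (hij : i ≠ j) :
    PairWinding M i j 0 := by
  obtain ⟨a, b, α, β, h⟩ := exists_sub_eq_lissajous hM i j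
  rw [PairWinding, h]
  refine hasWindingNumber_lissajous_of_odd_add ?_ (hcf.lissajous_ne_zero hij h)
  rcases Nat.even_or_odd p with h1 | h1 <;> rcases Nat.even_or_odd q with h2 | h2
  · have := Nat.dvd_gcd h1.two_dvd h2.two_dvd
    rw [hpq] at this
    omega
  · exact h1.add_odd h2
  · exact h1.add_even h2
  · rw [← Nat.not_even_iff_odd] at h1 h2
    exact absurd he (by tauto)

theorem pairWinding_one_or_neg_one_of_odd {N p q : ℕ} {x₀ y₀ φx φy : ℝ} {M : ℝ → Fin N → ℂ}
    (hM : M = typeI N p q x₀ y₀ φx φy ∨ M = typeII N p q x₀ y₀ φx φy) (hcf : CollisionFree M)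
    (hpq : Nat.Coprime p q) (hp : Odd p) (hq : Odd q) {i j : Fin N} (hij : i ≠ j) :
    PairWinding M i j 1 ∨ PairWinding M i j (-1) := by
  obtain ⟨a, b, α, β, h⟩ := exists_sub_eq_lissajous hM i j
  have hne := hcf.lissajous_ne_zero hij h
  obtain ⟨ha, hb⟩ := lissajous_amplitude_ne_zero hp.pos hq.pos hne
  obtain ⟨hs, hw⟩ := hasWindingNumber_lissajous_of_odd hp hq hpq hne
  rw [PairWinding, PairWinding, h]
  rcases neg_one_pow_eq_or ℝ ((p + q) / 2) with h1 | h1 <;>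
    rcases sign_cast_eq_or ha with h2 | h2 <;> rcases sign_cast_eq_or hb with h3 | h3 <;>
    rcases sign_cast_eq_or hs with h4 | h4 <;> rw [h1, h2, h3, h4] at hw <;>
    norm_num at hw <;> first | exact Or.inl hw | exact Or.inr hw

/-- The winding numbers in a formation of Type I with odd frequencies depend on the pair of
satellites only through the sign of an explicit trigonometric product. -/
theorem exists_pairWinding_typeI {N p q : ℕ} (hN : 2 ≤ N) {x₀ y₀ φx φy : ℝ}
    (hcf : CollisionFree (typeI N p q x₀ y₀ φx φy)) (hpq : Nat.Coprime p q) (hp : Odd p)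
    (hq : Odd q) :
    ∃ C : ℝ, (C = 1 ∨ C = -1) ∧ ∀ i j : Fin N, i ≠ j →
      Real.sin (Real.pi * p * (((j : ℕ) : ℝ) - (i : ℕ)) / N) *
        Real.sin (Real.pi * q * (((j : ℕ) : ℝ) - (i : ℕ)) / N) ≠ 0 ∧
      PairWinding (typeI N p q x₀ y₀ φx φy) i j (C * (SignType.sign
        (Real.sin (Real.pi * p * (((j : ℕ) : ℝ) - (i : ℕ)) / N) *
        Real.sin (Real.pi * q * (((j : ℕ) : ℝ) - (i : ℕ)) / N)) : ℝ)) := by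
  have hsub : ∀ i j : Fin N, _ := fun i j => funext (typeI_sub N p q x₀ y₀ φx φy i j)
  -- The pair-dependent parts of the phases are proportional to `p` and `q`, hence cancel. In Type
  -- II they are not.
  have hphase : ∀ i j : Fin N, (p : ℝ) * (Real.pi * q * ((i : ℕ) + (j : ℕ) + 2) / N + φy) -
      q * (Real.pi * p * ((i : ℕ) + (j : ℕ) + 2) / N + φx) = p * φy - q * φx := by
    intro i j
    ring
  have hamp : ∀ i j : Fin N, i ≠ j → x₀ ≠ 0 ∧ y₀ ≠ 0 ∧ Real.sin (p * φy - q * φx) ≠ 0 ∧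
      Real.sin (Real.pi * p * (((j : ℕ) : ℝ) - (i : ℕ)) / N) ≠ 0 ∧
      Real.sin (Real.pi * q * (((j : ℕ) : ℝ) - (i : ℕ)) / N) ≠ 0 := by
    intro i j hij
    have hne := hcf.lissajous_ne_zero hij (hsub i j)
    obtain ⟨ha, hb⟩ := lissajous_amplitude_ne_zero hp.pos hq.pos hne
    have hs := (hasWindingNumber_lissajous_of_odd hp hq hpq hne).1
    rw [hphase] at hs
    exact ⟨right_ne_zero_of_mul (left_ne_zero_of_mul ha),
      right_ne_zero_of_mul (left_ne_zero_of_mul hb), hs, right_ne_zero_of_mul ha,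
      right_ne_zero_of_mul hb⟩
  obtain ⟨hx, hy, hs, -, -⟩ := hamp ⟨0, by omega⟩ ⟨1, by omega⟩ (by simp)
  refine ⟨(-1) ^ ((p + q) / 2) * (SignType.sign x₀ : ℝ) * (SignType.sign y₀ : ℝ) *
    (SignType.sign (Real.sin (p * φy - q * φx)) : ℝ), ?_, fun i j hij => ?_⟩
  · rcases neg_one_pow_eq_or ℝ ((p + q) / 2) with h1 | h1 <;>
      rcases sign_cast_eq_or hx with h2 | h2 <;> rcases sign_cast_eq_or hy with h3 | h3 <;>
      rcases sign_cast_eq_or hs with h4 | h4 <;> rw [h1, h2, h3, h4] <;> norm_num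
  · obtain ⟨-, -, -, h1, h2⟩ := hamp i j hij
    refine ⟨mul_ne_zero h1 h2, ?_⟩
    have hw := (hasWindingNumber_lissajous_of_odd hp hq hpq
      (hcf.lissajous_ne_zero hij (hsub i j))).2
    rw [hphase, ← hsub i j] at hw
    simp only [sign_mul, SignType.coe_mul, sign_pos (zero_lt_two' ℝ),
      one_mul] at hw ⊢
    rw [PairWinding]
    convert hw using 1
    ring

/-! ### Orthogonality of sines and the sign dichotomy -/

/-- Real part of the geometric sum of `exp(iπm/N)`, an `N`-th root of unity because `m` is even, and
different from `1` because `2N` does not divide `m`. -/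
theorem sum_range_cos_eq_zero {N : ℕ} (hN : 0 < N) {m : ℤ} (hm : Even m)
    (hdvd : ¬ (2 * N : ℤ) ∣ m) :
    ∑ d ∈ Finset.range N, Real.cos (Real.pi * m * d / N) = 0 := by
  obtain ⟨r, rfl⟩ := hm
  have hN' : (N : ℂ) ≠ 0 := by exact_mod_cast hN.ne'
  have hpi : (Real.pi : ℂ) ≠ 0 := by exact_mod_cast Real.pi_ne_zero
  set z : ℂ := Complex.exp (((Real.pi * (r + r : ℤ) / N : ℝ) : ℂ) * Complex.I) with hz
  have hzN : z ^ N = 1 := by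
    rw [hz, ← Complex.exp_nat_mul, Complex.exp_eq_one_iff]
    refine ⟨r, ?_⟩
    push_cast
    field_simp
    ring
  have hz1 : z ≠ 1 := by
    intro h
    rw [hz, Complex.exp_eq_one_iff] at h
    obtain ⟨n, hn⟩ := h
    push_cast at hn
    field_simp at hn
    refine hdvd ⟨n, ?_⟩
    have : (r : ℂ) + r = 2 * N * n := by linear_combination hn
    exact_mod_cast this
  have hsum : ∑ d ∈ Finset.range N, z ^ d = 0 := by
    have := mul_geom_sum z N
    rw [hzN, sub_self] at this
    exact (mul_eq_zero.1 this).resolve_left (sub_ne_zero.2 hz1)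
  have hre : ∀ d ∈ Finset.range N, Real.cos (Real.pi * (r + r : ℤ) * d / N) = (z ^ d).re := by
    intro d _
    rw [hz, ← Complex.exp_nat_mul, ← mul_assoc, ← Complex.ofReal_natCast, ← Complex.ofReal_mul,
      Complex.exp_ofReal_mul_I_re]
    congr 1
    ring
  rw [Finset.sum_congr rfl hre, ← Complex.re_sum, hsum, Complex.zero_re]

/-- Orthogonality of the sines of frequencies `p` and `q` on the points `d / N`. -/
theorem sum_range_sin_mul_sin_eq_zero {N p q : ℕ} (hN : 0 < N) (hp : Odd p) (hq : Odd q)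
    (h1 : ¬ (2 * N : ℤ) ∣ (q : ℤ) - p) (h2 : ¬ (2 * N : ℤ) ∣ (q : ℤ) + p) :
    ∑ d ∈ Finset.range N, Real.sin (Real.pi * p * d / N) * Real.sin (Real.pi * q * d / N) = 0 := by
  have hp' : Odd (p : ℤ) := by exact_mod_cast hp
  have hq' : Odd (q : ℤ) := by exact_mod_cast hq
  have e1 := sum_range_cos_eq_zero hN (hq'.sub_odd hp') h1
  have e2 := sum_range_cos_eq_zero hN (hq'.add_odd hp') h2
  have h : ∀ d ∈ Finset.range N,
      Real.sin (Real.pi * p * d / N) * Real.sin (Real.pi * q * d / N) =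
      (Real.cos (Real.pi * ((q : ℤ) - p : ℤ) * d / N) -
        Real.cos (Real.pi * ((q : ℤ) + p : ℤ) * d / N)) / 2 := by
    intro d _
    have a1 : Real.pi * (((q : ℤ) - p : ℤ) : ℝ) * d / N =
        Real.pi * q * d / N - Real.pi * p * d / N := by
      push_cast
      ring
    have a2 : Real.pi * (((q : ℤ) + p : ℤ) : ℝ) * d / N =
        Real.pi * q * d / N + Real.pi * p * d / N := by
      push_cast
      ring
    rw [a1, a2, Real.cos_sub, Real.cos_add]
    ring
  rw [Finset.sum_congr rfl h, ← Finset.sum_div, Finset.sum_sub_distrib, e1, e2]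
  simp

/-- The two angles agree modulo `2π`, so the product is a square. -/
theorem sin_mul_sin_nonneg_of_dvd_sub {N p q : ℕ} (hN : 0 < N) (h : (2 * N : ℤ) ∣ (q : ℤ) - p)
    (d : ℤ) : 0 ≤ Real.sin (Real.pi * p * d / N) * Real.sin (Real.pi * q * d / N) := by
  obtain ⟨k, hk⟩ := h
  have hN' : (N : ℝ) ≠ 0 := by positivity
  have hk' : (q : ℝ) - p = 2 * N * k := by exact_mod_cast hk
  rw [show Real.pi * q * d / N = Real.pi * p * d / N + ((k * d : ℤ) : ℝ) * (2 * Real.pi) by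
    push_cast
    field_simp
    linear_combination (d : ℝ) * hk', Real.sin_add_int_mul_two_pi]
  exact mul_self_nonneg _

theorem sin_mul_sin_nonpos_of_dvd_add {N p q : ℕ} (hN : 0 < N) (h : (2 * N : ℤ) ∣ (q : ℤ) + p)
    (d : ℤ) : Real.sin (Real.pi * p * d / N) * Real.sin (Real.pi * q * d / N) ≤ 0 := by
  obtain ⟨k, hk⟩ := h
  have hN' : (N : ℝ) ≠ 0 := by positivity
  have hk' : (q : ℝ) + p = 2 * N * k := by exact_mod_cast hk
  rw [show Real.pi * q * d / N = -(Real.pi * p * d / N) + ((k * d : ℤ) : ℝ) * (2 * Real.pi) by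
    push_cast
    field_simp
    linear_combination (d : ℝ) * hk', Real.sin_add_int_mul_two_pi, Real.sin_neg]
  nlinarith [mul_self_nonneg (Real.sin (Real.pi * p * d / N))]

/-- The winding numbers in a formation of Type I with odd frequencies take both signs exactly
when the sines of frequencies `p` and `q` are orthogonal. -/
theorem pairWinding_typeI_both_signs_iff {N p q : ℕ} (hN : 2 ≤ N) {x₀ y₀ φx φy : ℝ}
    (hcf : CollisionFree (typeI N p q x₀ y₀ φx φy)) (hpq : Nat.Coprime p q) (hp : Odd p)
    (hq : Odd q) :
    ((∃ i j : Fin N, i ≠ j ∧ PairWinding (typeI N p q x₀ y₀ φx φy) i j 1) ∧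
        (∃ i j : Fin N, i ≠ j ∧ PairWinding (typeI N p q x₀ y₀ φx φy) i j (-1))) ↔
      (¬ (2 * N : ℤ) ∣ (q : ℤ) - p ∧ ¬ (2 * N : ℤ) ∣ (q : ℤ) + p) := by
  obtain ⟨C, hC, hw⟩ := exists_pairWinding_typeI hN hcf hpq hp hq
  set f : ℝ → ℝ := fun d => Real.sin (Real.pi * p * d / N) * Real.sin (Real.pi * q * d / N) with hf
  have hfw : ∀ i j : Fin N, i ≠ j → f (((j : ℕ) : ℝ) - (i : ℕ)) ≠ 0 ∧
      PairWinding (typeI N p q x₀ y₀ φx φy) i j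
        (C * (SignType.sign (f (((j : ℕ) : ℝ) - (i : ℕ))) : ℝ)) := hw
  have hcast : ∀ i j : Fin N, ((((j : ℕ) : ℤ) - (i : ℕ) : ℤ) : ℝ) = ((j : ℕ) : ℝ) - (i : ℕ) := by
    intro i j
    push_cast
    rfl
  constructor
  · rintro ⟨⟨i, j, hij, h1⟩, k, l, hkl, h2⟩
    have e1 := h1.unique (hfw i j hij).2
    have e2 := h2.unique (hfw k l hkl).2
    have n1 := (hfw i j hij).1
    have n2 := (hfw k l hkl).1
    constructor <;> intro hdvd
    -- All windings would equal `C`, which cannot be both `1` and `-1`.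
    · have hpos : ∀ i j : Fin N, 0 ≤ f (((j : ℕ) : ℝ) - (i : ℕ)) := fun i j => by
        rw [← hcast]
        exact sin_mul_sin_nonneg_of_dvd_sub (by omega) hdvd _
      rw [sign_pos ((hpos i j).lt_of_ne n1.symm)] at e1
      rw [sign_pos ((hpos k l).lt_of_ne n2.symm)] at e2
      linarith
    · have hneg : ∀ i j : Fin N, f (((j : ℕ) : ℝ) - (i : ℕ)) ≤ 0 := fun i j => by
        rw [← hcast]
        exact sin_mul_sin_nonpos_of_dvd_add (by omega) hdvd _
      rw [sign_neg ((hneg i j).lt_of_ne n1)] at e1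
      rw [sign_neg ((hneg k l).lt_of_ne n2)] at e2
      linarith
  · rintro ⟨h1, h2⟩
    have hsum : ∑ d ∈ Finset.range N, f d = 0 :=
      sum_range_sin_mul_sin_eq_zero (by omega) hp hq h1 h2
    have hpair : ∀ d ∈ Finset.range N, f d ≠ 0 → ∃ i j : Fin N, i ≠ j ∧
        PairWinding (typeI N p q x₀ y₀ φx φy) i j (C * (SignType.sign (f d) : ℝ)) := by
      intro d hd hfd
      have hd0 : d ≠ 0 := by
        rintro rfl
        simp [hf] at hfd
      have hij : (⟨0, by omega⟩ : Fin N) ≠ ⟨d, Finset.mem_range.1 hd⟩ := by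
        simpa using hd0.symm
      refine ⟨_, _, hij, ?_⟩
      simpa using (hfw _ _ hij).2
    -- Collision-freeness makes one term nonzero, so a vanishing sum has terms of both signs; a
    -- nonzero term at `d` is realised by the pair of indices `0`, `d`.
    have hf1 : f ((1 : ℕ) : ℝ) ≠ 0 := by
      have := (hfw ⟨0, by omega⟩ ⟨1, by omega⟩ (by simp)).1
      simpa using this
    have hmem : 1 ∈ Finset.range N := Finset.mem_range.2 (by omega)
    obtain ⟨d, hd, hdpos⟩ := Finset.exists_pos_of_sum_zero_of_exists_nonzero _ hsum ⟨1, hmem, hf1⟩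
    obtain ⟨e, he, heneg⟩ := Finset.exists_pos_of_sum_zero_of_exists_nonzero
      (fun d : ℕ => -f d) (by rw [Finset.sum_neg_distrib, hsum, neg_zero])
      ⟨1, hmem, neg_ne_zero.2 hf1⟩
    have wd := hpair d hd hdpos.ne'
    have we := hpair e he (neg_pos.1 heneg).ne
    rw [sign_pos hdpos] at wd
    rw [sign_neg (neg_pos.1 heneg)] at we
    rcases hC with rfl | rfl
    · exact ⟨by simpa using wd, by simpa using we⟩
    · exact ⟨by simpa using we, by simpa using wd⟩

theorem proposition2 (N : ℕ) (hN : 2 ≤ N) (p q : ℕ) (hp : 0 < p) (hq : 0 < q)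
    (hpq : Nat.Coprime p q) (x₀ y₀ φx φy : ℝ) :
    -- part (a), for both types of formation
    (∀ M : ℝ → Fin N → ℂ, (M = typeI N p q x₀ y₀ φx φy ∨ M = typeII N p q x₀ y₀ φx φy) →
      CollisionFree M →
        ((Even p ∨ Even q) → ∀ i j : Fin N, i ≠ j → PairWinding M i j 0) ∧
        (Odd p ∧ Odd q →
          (∀ i j : Fin N, i ≠ j → PairWinding M i j 1 ∨ PairWinding M i j (-1)) ∧
          WeaklyEntangled M)) ∧
    -- part (b), for Type I
    (CollisionFree (typeI N p q x₀ y₀ φx φy) → Odd p → Odd q →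
      (((∃ i j : Fin N, i ≠ j ∧ PairWinding (typeI N p q x₀ y₀ φx φy) i j 1) ∧
          (∃ i j : Fin N, i ≠ j ∧ PairWinding (typeI N p q x₀ y₀ φx φy) i j (-1))) ↔
        (¬ (2 * N : ℤ) ∣ (q : ℤ) - p ∧ ¬ (2 * N : ℤ) ∣ (q : ℤ) + p)) ∧
      (¬ (2 * N : ℤ) ∣ (q : ℤ) - p → ¬ (2 * N : ℤ) ∣ (q : ℤ) + p →
        WeaklyEntangled (typeI N p q x₀ y₀ φx φy) ∧
        StronglyEntangled (typeI N p q x₀ y₀ φx φy))) := by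
  have hij : (⟨0, by omega⟩ : Fin N) ≠ ⟨1, by omega⟩ := by simp
  refine ⟨fun M hM hcf => ⟨fun he i j => pairWinding_zero_of_even hM hcf hpq he,
    fun ho => ?_⟩, fun hcf hop hoq => ?_⟩
  · have h := fun i j => pairWinding_one_or_neg_one_of_odd hM hcf hpq ho.1 ho.2 (i := i) (j := j)
    refine ⟨h, ?_⟩
    rcases h _ _ hij with hw | hw
    · exact weaklyEntangled_of_pairWinding hij hw one_ne_zero
    · exact weaklyEntangled_of_pairWinding hij hw (by norm_num)
  · have hiff := pairWinding_typeI_both_signs_iff hN hcf hpq hop hoq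
    refine ⟨hiff, fun h1 h2 => ?_⟩
    obtain ⟨⟨i, j, hij, hw⟩, k, l, hkl, hw'⟩ := hiff.2 ⟨h1, h2⟩
    exact ⟨weaklyEntangled_of_pairWinding hij hw one_ne_zero,
      stronglyEntangled_of_pairWinding_ne hij hkl hw hw' (by norm_num)⟩
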